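/- Let $G=(V,E)$ be a finite connected simple graph with positive edge weights $W:E\to\mathbb{R}_{>0}$; the weight $W(p)$ of a path $p$ is the sum of the weights of its edges. A *path choice function* $g$ on $G$ selects for all $v,w\in V$ a path $g(v,w)$ in $G$ from $v$ to $w$, such that every segment of a selected path, from a vertex $x$ to a later vertex $y$ on it, is the selected path $g(x,y)$. A *path-representable distance* along $g$ is a symmetric function $d:V\times V\to\mathbb{R}$ with $d(v,w)=W(g(v,w))$ for all $v,w$ (the triangle inequality is not required). The function $g$ is *cost-dominated* if $W(g(v,w))\le W(\{v,w\})$ for every edge $\{v,w\}\in E$. For such a $d$ and a nonempty $\sigma\subseteq V$ put $f_d(\sigma)=\max_{v,w\in\sigma}d(v,w)$ (the Vietoris–Rips filtration of the full simplex on $V$). Given a total order $\pi$ on the nonempty subsets of $V$ in which proper faces precede, order the simplices by $f_d$, ties being broken by $\pi$. Let $D$ be the boundary matrix over $\mathbb{F}_2$ of the full simplex on $V$, and let $R=DU$ be a decomposition with $U$ invertible upper triangular in this order and $R$ reduced, that is, distinct nonzero columns $\tau$ of $R$ have distinct lowest nonzero entries $\mathrm{low}_R(\tau)$; such a decomposition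 always exists. The degree-one barcode $\mathbf{bcd}_1(d)$ consists of one bar $[f_d(\sigma),f_d(\tau)]_\sigma$ for each pair $(\sigma,\tau)$ with $\dim\sigma=1$, $\sigma=\mathrm{low}_R(\tau)$ and $f_d(\sigma)<f_d(\tau)$; the $1$-simplex $\sigma$ is called its birth edge. **Theorem.** Let $d_1,d_2$ be path-representable distances on $G$ along cost-dominated path choice functions $g_1,g_2$, and suppose $d_2(v,w)\le d_1(v,w)$ for all $v,w\in V$. Then there is an order $\pi$ as above, the same for $d_1$ and $d_2$, such that for any decompositions $R_1=DU_1$ and $R_2=DU_2$ as above for $d_1$ and $d_2$ there is an injection $\varphi:\mathbf{bcd}_1(d_2)\to\mathbf{bcd}_1(d_1)$ that sends each bar $[a,b]_\sigma$ to a bar $[a,b']_\sigma$ with the same birth edge $\sigma$, the same birth value $a$, and $b\le b'$. -/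

import Mathlib

/-- The total weight `∑_{e ∈ p} W e` of a walk `p`. -/
def walkWeight {V : Type*} {G : SimpleGraph V} (W : Sym2 V → ℝ) {v w : V} (p : G.Walk v w) : ℝ :=
  (p.edges.map W).sum

/-- A path choice function on `G`: it selects, for all vertices `v` and `w`, a path from `v` to `w`
in `G`, consistently, in the sense that every segment of a selected path is itself the selected path
between its endpoints. -/
structure PathChoice {V : Type*} (G : SimpleGraph V) where
  path : ∀ v w : V, G.Walk v w
  isPath : ∀ v w : V, (path v w).IsPath
  consistent : ∀ (v x y w : V) (p : G.Walk v x) (q : G.Walk x y) (r : G.Walk y w),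
    path v w = p.append (q.append r) → path x y = q

/-- `g` is cost-dominated: the path selected between the endpoints of an edge has total weight at
most the weight of that edge. -/
def PathChoice.CostDominated {V : Type*} {G : SimpleGraph V} (g : PathChoice G)
    (W : Sym2 V → ℝ) : Prop :=
  ∀ v w : V, G.Adj v w → walkWeight W (g.path v w) ≤ W s(v, w)

/-- `d` is the path-representable distance along `g`: a symmetric function whose value at `(v, w)`
is the total weight of the path selected by `g` between `v` and `w`. (For positive weights,
`d v w ≥ 0` with equality exactly for `v = w` is automatic; the triangle inequality is not part of
the notion of distance.) -/
def PathChoice.IsDistanceAlong {V : Type*} {G : SimpleGraph V} (g : PathChoice G)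
    (W : Sym2 V → ℝ) (d : V → V → ℝ) : Prop :=
  (∀ v w : V, d v w = d w v) ∧ ∀ v w : V, d v w = walkWeight W (g.path v w)

/-- The simplices of the full simplicial complex on `V`: the nonempty finite sets of vertices. -/
abbrev Simplex (V : Type*) : Type _ := {s : Finset V // s.Nonempty}

/-- The Vietoris–Rips filtration value of a simplex: the maximum of `d v w` over its vertices.
The Vietoris–Rips complex at scale `t` is `{σ | ripsValue d σ ≤ t}`. -/
noncomputable def ripsValue {V : Type*} (d : V → V → ℝ) (σ : Simplex V) : ℝ :=
  (σ.1 ×ˢ σ.1).sup' (σ.2.product σ.2) (fun x => d x.1 x.2)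

/-- A total order on the simplices (given by an injective rank function) in which every proper face
of a simplex comes before that simplex. -/
structure SimplexOrder (V : Type*) where
  rank : Simplex V → ℕ
  injective : Function.Injective rank
  face_lt : ∀ σ τ : Simplex V, σ.1 ⊂ τ.1 → rank σ < rank τ

/-- The position of a simplex in the filtration of `d`: simplices are ordered by filtration value,
and those with equal value by `π`. -/
noncomputable def filtrationKey {V : Type*} (d : V → V → ℝ) (π : SimplexOrder V)
    (σ : Simplex V) : ℝ ×ₗ ℕ :=
  toLex (ripsValue d σ, π.rank σ)

/-- The boundary matrix over `𝔽₂` of the full simplicial complex on `V`: the entry at `(ρ, τ)` is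
`1` exactly if `ρ` is a face of `τ` of codimension one. -/
def boundaryMatrix (V : Type*) [DecidableEq V] : Matrix (Simplex V) (Simplex V) (ZMod 2) :=
  fun ρ τ => if ρ.1 ⊆ τ.1 ∧ τ.1.card = ρ.1.card + 1 then 1 else 0

/-- `low_R(τ) = σ`: the column `τ` of `R` is nonzero, and `σ` is the row of its last nonzero entry
in the filtration order. -/
def IsLow {V : Type*} (d : V → V → ℝ) (π : SimplexOrder V)
    (R : Matrix (Simplex V) (Simplex V) (ZMod 2)) (σ τ : Simplex V) : Prop :=
  R σ τ ≠ 0 ∧ ∀ ρ : Simplex V, R ρ τ ≠ 0 → filtrationKey d π ρ ≤ filtrationKey d π σ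

/-- A decomposition `R = D U` of the boundary matrix `D`, where, with respect to the filtration
order, `U` is an invertible upper triangular matrix and `R` is reduced, that is, distinct nonzero
columns of `R` have distinct lows. -/
structure Reduction {V : Type*} [Fintype V] [DecidableEq V] (d : V → V → ℝ)
    (π : SimplexOrder V) where
  R : Matrix (Simplex V) (Simplex V) (ZMod 2)
  U : Matrix (Simplex V) (Simplex V) (ZMod 2)
  eq_mul : R = boundaryMatrix V * U
  upper : ∀ σ τ : Simplex V, U σ τ ≠ 0 → filtrationKey d π σ ≤ filtrationKey d π τ
  diag : ∀ σ : Simplex V, U σ σ = 1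
  reduced : ∀ σ τ τ' : Simplex V, IsLow d π R σ τ → IsLow d π R σ τ' → τ = τ'

/-- Such a decomposition always exists. -/
theorem nonempty_reduction {V : Type*} [Fintype V] [DecidableEq V] (d : V → V → ℝ)
    (π : SimplexOrder V) : Nonempty (Reduction d π) := by
  classical
  let K := filtrationKey d π
  let D := boundaryMatrix V
  have Kinj : Function.Injective K := by
    intro a b h
    have h' : (ripsValue d a, π.rank a) = (ripsValue d b, π.rank b) := toLex.injective h
    exact π.injective (Prod.ext_iff.1 h').2
  let ht : (Simplex V → ZMod 2) → WithBot (ℝ ×ₗ ℕ) := fun c =>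
    (Finset.univ.filter fun ρ => c ρ ≠ 0).sup fun ρ => ((K ρ : ℝ ×ₗ ℕ) : WithBot (ℝ ×ₗ ℕ))
  let Adm : Simplex V → Finset (Simplex V → ZMod 2) := fun τ =>
    Finset.univ.filter fun u => u τ = 1 ∧ ∀ σ, u σ ≠ 0 → K σ ≤ K τ
  have hne : ∀ τ, (Adm τ).Nonempty := by
    intro τ
    refine ⟨Pi.single τ 1, ?_⟩
    simp only [Adm, Finset.mem_filter, Finset.mem_univ, true_and, Pi.single_eq_same]
    intro σ hσ
    by_cases h : σ = τ
    · rw [h]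
    · simp [h] at hσ
  have hmin := fun τ => Finset.exists_min_image (Adm τ) (fun u => ht (D.mulVec u)) (hne τ)
  choose u hu hmin using hmin
  have hu' : ∀ τ, u τ τ = 1 ∧ ∀ σ, u τ σ ≠ 0 → K σ ≤ K τ := fun τ =>
    (Finset.mem_filter.1 (hu τ)).2
  have hcol : ∀ ρ τ, (D * Matrix.of fun σ τ => u τ σ) ρ τ = D.mulVec (u τ) ρ := fun ρ τ => rfl
  have key : ∀ σ τ τ' : Simplex V, IsLow d π (D * Matrix.of fun σ τ => u τ σ) σ τ →
      IsLow d π (D * Matrix.of fun σ τ => u τ σ) σ τ' → ¬ K τ < K τ' := by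
    intro σ τ τ' h h' hlt
    simp only [IsLow, hcol] at h h'
    have z2 : ∀ a b : ZMod 2, a ≠ 0 → b ≠ 0 → a + b = 0 := by decide
    have hmem : u τ + u τ' ∈ Adm τ' := by
      simp only [Adm, Finset.mem_filter, Finset.mem_univ, true_and, Pi.add_apply]
      refine ⟨?_, ?_⟩
      · have : u τ τ' = 0 := by
          by_contra hc
          exact absurd ((hu' τ).2 τ' hc) (not_le.2 hlt)
        rw [this, (hu' τ').1, zero_add]
      · intro ρ hρ
        by_cases h1 : u τ ρ = 0
        · exact (hu' τ').2 ρ (by simpa [h1] using hρ)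
        · exact ((hu' τ).2 ρ h1).trans hlt.le
    have hle := hmin τ' _ hmem
    refine absurd hle (not_le.2 ?_)
    have hge : ((K σ : ℝ ×ₗ ℕ) : WithBot (ℝ ×ₗ ℕ)) ≤ ht (D.mulVec (u τ')) :=
      Finset.le_sup (f := fun ρ => ((K ρ : ℝ ×ₗ ℕ) : WithBot (ℝ ×ₗ ℕ)))
        (Finset.mem_filter.2 ⟨Finset.mem_univ _, h'.1⟩)
    refine lt_of_lt_of_le ?_ hge
    refine (Finset.sup_lt_iff (WithBot.bot_lt_coe _)).2 ?_
    intro ρ hρ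
    have hρ' := (Finset.mem_filter.1 hρ).2
    rw [Matrix.mulVec_add, Pi.add_apply] at hρ'
    have hKle : K ρ ≤ K σ := by
      by_cases h1 : D.mulVec (u τ) ρ = 0
      · exact h'.2 ρ (by simpa [h1] using hρ')
      · exact h.2 ρ h1
    refine WithBot.coe_lt_coe.2 (lt_of_le_of_ne hKle fun he => ?_)
    rw [Kinj he] at hρ'
    exact hρ' (z2 _ _ h.1 h'.1)
  exact ⟨{
    R := D * Matrix.of fun σ τ => u τ σ
    U := Matrix.of fun σ τ => u τ σ
    eq_mul := rfl
    upper := fun σ τ h => (hu' τ).2 σ h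
    diag := fun σ => (hu' σ).1
    reduced := fun σ τ τ' h h' => Kinj (le_antisymm
      (not_lt.1 (key σ τ' τ h' h)) (not_lt.1 (key σ τ τ' h h'))) }⟩

/-- The degree-one Vietoris–Rips persistence barcode `bcd_1(d)`, read off from a decomposition: the
pairs `(σ, τ)` with `dim σ = 1`, `low_R(τ) = σ` and birth value smaller than death value. There are
no infinite bars in degree one, because the filtration ends with a full simplex. -/
def Reduction.barcodeOne {V : Type*} [Fintype V] [DecidableEq V] {d : V → V → ℝ}
    {π : SimplexOrder V} (A : Reduction d π) : Set (Simplex V × Simplex V) :=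
  {x | x.1.1.card = 2 ∧ IsLow d π A.R x.1 x.2 ∧ ripsValue d x.1 < ripsValue d x.2}

/-- The birth simplex of a bar. -/
def Reduction.birthEdge {V : Type*} [Fintype V] [DecidableEq V] {d : V → V → ℝ}
    {π : SimplexOrder V} {A : Reduction d π} (x : A.barcodeOne) : Simplex V := x.1.1

/-- The left endpoint `a` of a bar `[a, b]`. -/
noncomputable def Reduction.birth {V : Type*} [Fintype V] [DecidableEq V] {d : V → V → ℝ}
    {π : SimplexOrder V} {A : Reduction d π} (x : A.barcodeOne) : ℝ := ripsValue d x.1.1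

/-- The right endpoint `b` of a bar `[a, b]`. -/
noncomputable def Reduction.death {V : Type*} [Fintype V] [DecidableEq V] {d : V → V → ℝ}
    {π : SimplexOrder V} {A : Reduction d π} (x : A.barcodeOne) : ℝ := ripsValue d x.1.2

/-!
Why the theorem holds, for *any* order `π` of the simplices.

By the pairing lemma (`Reduction.exists_isLow`), a simplex `σ` is a low of the reduced matrix as
soon as some chain has a boundary with leading simplex `σ`, and the column it belongs to comes no
later than the last simplex of that chain.

Let `σ = {v, w}` be the birth edge of a bar of `d₂`. If the path selected by `g₂` from `v` to `w`
had an inner vertex `x`, then `d₂ v w = d₂ v x + d₂ x w`, so the triangle `{v, x, w}` would enter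
together with its strictly longest edge `σ`, and `σ` would be paired at persistence zero. Hence the
selected path is the edge `vw` itself (`adj_of_isLow_of_lt`); as `g₁` is cost-dominated and
`d₂ ≤ d₁`, the value of `σ` is `W s(v, w)` for both distances.

* A chain whose boundary has leading simplex `σ` for `d₁` has the same leading simplex for `d₂`,
  since filtration values do not increase while that of `σ` is unchanged. So `σ` dies for `d₂` no
  later than for `d₁`.
* `σ` is a low for `d₁`: each edge `{a, b}` that precedes `σ` for `d₂` is either unchanged, or
  the path selected by `g₂` joins `a` to `b` by shorter edges, which precede `σ` for `d₁`
  (`precedes_reachable`). Since `σ` closes a cycle for `d₂`, its endpoints are therefore joined by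
  edges preceding it for `d₁` (`related_of_boundary_ne_zero`), and coning off the resulting closed
  path gives a chain with boundary led by `σ` (`exists_isLeading_boundary_of_reachable`).

The two points together give the bar of `d₁` born at `σ`, and its positive length.
-/

open Matrix

/-! ### The filtration order -/

section Order

variable {V : Type*} (d : V → V → ℝ) (π : SimplexOrder V)

theorem filtrationKey_injective : Function.Injective (filtrationKey d π) := by
  intro a b h
  have h' : (ripsValue d a, π.rank a) = (ripsValue d b, π.rank b) := toLex.injective h
  exact π.injective (Prod.ext_iff.1 h').2

theorem filtrationKey_le_iff {d : V → V → ℝ} {π : SimplexOrder V} {ρ σ : Simplex V} :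
    filtrationKey d π ρ ≤ filtrationKey d π σ ↔
      ripsValue d ρ < ripsValue d σ ∨ ripsValue d ρ = ripsValue d σ ∧ π.rank ρ ≤ π.rank σ :=
  Prod.Lex.toLex_le_toLex

theorem filtrationKey_lt_iff {d : V → V → ℝ} {π : SimplexOrder V} {ρ σ : Simplex V} :
    filtrationKey d π ρ < filtrationKey d π σ ↔
      ripsValue d ρ < ripsValue d σ ∨ ripsValue d ρ = ripsValue d σ ∧ π.rank ρ < π.rank σ :=
  Prod.Lex.toLex_lt_toLex

theorem ripsValue_le_of_filtrationKey_le {d : V → V → ℝ} {π : SimplexOrder V} {ρ σ : Simplex V}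
    (h : filtrationKey d π ρ ≤ filtrationKey d π σ) : ripsValue d ρ ≤ ripsValue d σ := by
  rcases filtrationKey_le_iff.1 h with h | h
  exacts [h.le, h.1.le]

theorem ripsValue_mono {d₁ d₂ : V → V → ℝ} (hle : ∀ v w, d₂ v w ≤ d₁ v w) (σ : Simplex V) :
    ripsValue d₂ σ ≤ ripsValue d₁ σ :=
  Finset.sup'_mono_fun fun x _ => hle x.1 x.2

/-- Ordering by cardinality, ties broken by an arbitrary enumeration, puts faces first. -/
theorem nonempty_simplexOrder [Fintype V] : Nonempty (SimplexOrder V) := by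
  classical
  let e := Fintype.equivFin (Simplex V)
  refine ⟨⟨fun s => (e s : ℕ) + Fintype.card (Simplex V) * s.1.card, ?_, ?_⟩⟩
  · intro s t h
    have h' := congrArg (· % Fintype.card (Simplex V)) h
    simp only [Nat.add_mul_mod_self_left, Nat.mod_eq_of_lt (e s).2,
      Nat.mod_eq_of_lt (e t).2] at h'
    exact e.injective (Fin.ext h')
  · intro σ τ h
    have h1 := (e σ).2
    have h2 := Nat.mul_le_mul_left (Fintype.card (Simplex V)) (Finset.card_lt_card h)
    rw [Nat.succ_eq_add_one, Nat.mul_add, Nat.mul_one] at h2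
    show _ < _
    omega

end Order

/-! ### Leading simplices and the pairing lemma -/

/-- `σ` is the leading simplex of the chain `z`: the last simplex, in the filtration order, on
which the chain is nonzero. `IsLow d π R σ τ` says that `σ` leads the column `τ` of `R`. -/
def IsLeading {V : Type*} (d : V → V → ℝ) (π : SimplexOrder V) (z : Simplex V → ZMod 2)
    (σ : Simplex V) : Prop :=
  z σ ≠ 0 ∧ ∀ ρ : Simplex V, z ρ ≠ 0 → filtrationKey d π ρ ≤ filtrationKey d π σ

section Pairing

variable {V : Type*} [Fintype V] {d : V → V → ℝ} {π : SimplexOrder V}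

theorem exists_isLeading {z : Simplex V → ZMod 2} {σ : Simplex V} (hσ : z σ ≠ 0) :
    ∃ μ, IsLeading d π z μ := by
  obtain ⟨μ, hμ, hmax⟩ := Finset.exists_max_image (Finset.univ.filter fun ρ => z ρ ≠ 0)
    (filtrationKey d π) ⟨σ, by simpa using hσ⟩
  exact ⟨μ, by simpa using hμ, fun ρ hρ => hmax ρ (by simpa using hρ)⟩

variable [DecidableEq V]

/-- A unitriangular matrix preserves leading simplices. -/
theorem Reduction.mulVec_leading_ne_zero (A : Reduction d π) {u : Simplex V → ZMod 2}
    {μ : Simplex V} (h : IsLeading d π u μ) : (A.U *ᵥ u) μ ≠ 0 := by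
  have : (A.U *ᵥ u) μ = A.U μ μ * u μ := by
    refine Finset.sum_eq_single μ (fun ρ _ hρ => ?_) (by simp)
    by_contra hne
    exact hρ (filtrationKey_injective d π
      (le_antisymm (h.2 ρ (right_ne_zero_of_mul hne)) (A.upper μ ρ (left_ne_zero_of_mul hne))))
  rw [this, A.diag, one_mul]
  exact h.1

theorem Reduction.mulVec_surjective (A : Reduction d π) :
    Function.Surjective fun u : Simplex V → ZMod 2 => A.U *ᵥ u := by
  refine Finite.surjective_of_injective ?_
  intro u u' h
  by_contra hne
  obtain ⟨σ, hσ⟩ := Function.ne_iff.1 (sub_ne_zero.2 hne)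
  obtain ⟨μ, hμ⟩ := exists_isLeading (d := d) (π := π) hσ
  refine A.mulVec_leading_ne_zero hμ ?_
  have h' : A.U *ᵥ u = A.U *ᵥ u' := h
  rw [Matrix.mulVec_sub, h', sub_self, Pi.zero_apply]

/-- In a combination of the columns of the reduced matrix nothing cancels at the largest low, so
that low leads the combination. -/
theorem Reduction.exists_isLow_of_isLeading_mulVec (A : Reduction d π) {u : Simplex V → ZMod 2}
    {σ : Simplex V} (h : IsLeading d π (A.R *ᵥ u) σ) : ∃ τ, u τ ≠ 0 ∧ IsLow d π A.R σ τ := by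
  classical
  obtain ⟨τ₀, -, hτ₀⟩ := Finset.exists_ne_zero_of_sum_ne_zero h.1
  have hlow : ∀ ρ τ, A.R ρ τ ≠ 0 → ∃ μ, IsLow d π A.R μ τ := fun ρ τ hρ =>
    exists_isLeading (z := fun ρ => A.R ρ τ) hρ
  obtain ⟨μ₀, hμ₀⟩ := hlow σ τ₀ (left_ne_zero_of_mul hτ₀)
  obtain ⟨μ, hμ, hmax⟩ := Finset.exists_max_image
    (Finset.univ.filter fun μ => ∃ τ, u τ ≠ 0 ∧ IsLow d π A.R μ τ)
    (filtrationKey d π) ⟨μ₀, Finset.mem_filter.2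
      ⟨Finset.mem_univ _, τ₀, right_ne_zero_of_mul hτ₀, hμ₀⟩⟩
  simp only [Finset.mem_filter, Finset.mem_univ, true_and] at hμ hmax
  obtain ⟨τ, hτ, hμτ⟩ := hμ
  have hval : (A.R *ᵥ u) μ = A.R μ τ * u τ := by
    refine Finset.sum_eq_single τ (fun τ' _ hne => ?_) (by simp)
    by_contra hne0
    obtain ⟨μ', hμ'⟩ := hlow μ τ' (left_ne_zero_of_mul hne0)
    have : μ' = μ := filtrationKey_injective d π
      (le_antisymm (hmax μ' ⟨τ', right_ne_zero_of_mul hne0, hμ'⟩)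
        (hμ'.2 μ (left_ne_zero_of_mul hne0)))
    subst this
    exact hne (A.reduced _ _ _ hμ' hμτ)
  have hμσ : μ = σ := by
    refine filtrationKey_injective d π (le_antisymm (h.2 μ ?_) ?_)
    · rw [hval]
      exact mul_ne_zero hμτ.1 hτ
    · exact (hμ₀.2 σ (left_ne_zero_of_mul hτ₀)).trans
        (hmax μ₀ ⟨τ₀, right_ne_zero_of_mul hτ₀, hμ₀⟩)
  exact ⟨τ, hτ, hμσ ▸ hμτ⟩

/-- The pairing lemma: if the boundary of a chain `c` has leading simplex `σ`, then `σ` is the low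
of a column that comes no later than the last simplex of `c`. -/
theorem Reduction.exists_isLow (A : Reduction d π) {c : Simplex V → ZMod 2} {σ : Simplex V}
    (h : IsLeading d π (boundaryMatrix V *ᵥ c) σ) :
    ∃ τ, IsLow d π A.R σ τ ∧ ∃ ρ, c ρ ≠ 0 ∧ ripsValue d τ ≤ ripsValue d ρ := by
  obtain ⟨u, rfl⟩ := A.mulVec_surjective c
  simp only [Matrix.mulVec_mulVec, ← A.eq_mul] at h
  obtain ⟨τ, hτ, hlow⟩ := A.exists_isLow_of_isLeading_mulVec h
  obtain ⟨μ, hμ⟩ := exists_isLeading (d := d) (π := π) hτ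
  exact ⟨τ, hlow, μ, A.mulVec_leading_ne_zero hμ, ripsValue_le_of_filtrationKey_le (hμ.2 τ hτ)⟩

/-- Conversely, a low leads the boundary of a chain, namely of a column of `U`. -/
theorem Reduction.isLeading_of_isLow (A : Reduction d π) {σ τ : Simplex V}
    (h : IsLow d π A.R σ τ) :
    IsLeading d π (boundaryMatrix V *ᵥ fun ρ => A.U ρ τ) σ := by
  have : (boundaryMatrix V *ᵥ fun ρ => A.U ρ τ) = fun ρ => A.R ρ τ := by
    rw [A.eq_mul]
    rfl
  rw [this]
  exact h

end Pairing

/-! ### Edges, triangles and their boundaries -/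

section Boundary

variable {V : Type*} [DecidableEq V]

/-- The edge `{a, b}`; for `a = b` it degenerates to a vertex. -/
def edgeSimplex (a b : V) : Simplex V := ⟨{a, b}, Finset.insert_nonempty _ _⟩

/-- The triangle `{a, b, c}`, degenerate if two of the vertices agree. -/
def triangleSimplex (a b c : V) : Simplex V := ⟨{a, b, c}, Finset.insert_nonempty _ _⟩

theorem edgeSimplex_comm (a b : V) : edgeSimplex a b = edgeSimplex b a :=
  Subtype.ext (Finset.pair_comm a b)

theorem edgeSimplex_ne_of_ne {v u u' : V} (h : u ≠ v) (h' : u ≠ u') :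
    edgeSimplex v u ≠ edgeSimplex v u' := by
  intro he
  have : u ∈ (edgeSimplex v u').1 := he ▸ (by simp [edgeSimplex] : u ∈ (edgeSimplex v u).1)
  simp [edgeSimplex, h, h'] at this

theorem exists_edgeSimplex_eq {σ : Simplex V} (h : σ.1.card = 2) :
    ∃ a b, a ≠ b ∧ σ = edgeSimplex a b := by
  obtain ⟨a, b, hab, he⟩ := Finset.card_eq_two.1 h
  exact ⟨a, b, hab, Subtype.ext he⟩

theorem card_edgeSimplex {a b : V} (h : a ≠ b) : (edgeSimplex a b).1.card = 2 :=
  Finset.card_pair h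

theorem boundaryMatrix_triangle_apply {a b c : V} (hab : a ≠ b) (hac : a ≠ c) (hbc : b ≠ c)
    (ρ : Simplex V) :
    boundaryMatrix V ρ (triangleSimplex a b c) =
      (Pi.single (edgeSimplex a b) 1 + Pi.single (edgeSimplex a c) 1 +
        Pi.single (edgeSimplex b c) 1 : Simplex V → ZMod 2) ρ := by
  have h3 : ({a, b, c} : Finset V).card = 3 := Finset.card_eq_three.2 ⟨a, b, c, hab, hac, hbc, rfl⟩
  have n1 : edgeSimplex a b ≠ edgeSimplex a c := edgeSimplex_ne_of_ne hab.symm hbc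
  have n2 : edgeSimplex a b ≠ edgeSimplex b c := by
    rw [edgeSimplex_comm a b]; exact edgeSimplex_ne_of_ne hab hac
  have n3 : edgeSimplex a c ≠ edgeSimplex b c := by
    rw [edgeSimplex_comm a c, edgeSimplex_comm b c]; exact edgeSimplex_ne_of_ne hac hab
  have key : (ρ.1 ⊆ (triangleSimplex a b c).1 ∧
      (triangleSimplex a b c).1.card = ρ.1.card + 1) ↔
      ρ = edgeSimplex a b ∨ ρ = edgeSimplex a c ∨ ρ = edgeSimplex b c := by
    constructor
    · rintro ⟨hs, hc⟩
      have hc2 : ρ.1.card = 2 := by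
        have : (triangleSimplex a b c).1.card = 3 := h3
        omega
      obtain ⟨x, y, hxy, rfl⟩ := exists_edgeSimplex_eq hc2
      have hx : x ∈ ({a, b, c} : Finset V) := hs (by simp [edgeSimplex])
      have hy : y ∈ ({a, b, c} : Finset V) := hs (by simp [edgeSimplex])
      simp only [Finset.mem_insert, Finset.mem_singleton] at hx hy
      rcases hx with rfl | rfl | rfl <;> rcases hy with rfl | rfl | rfl <;>
        simp_all [edgeSimplex_comm]
    · have : (triangleSimplex a b c).1.card = 3 := h3
      rintro (rfl | rfl | rfl)
      · rw [this, card_edgeSimplex hab]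
        exact ⟨by intro z; simp [edgeSimplex, triangleSimplex]; tauto, rfl⟩
      · rw [this, card_edgeSimplex hac]
        exact ⟨by intro z; simp [edgeSimplex, triangleSimplex]; tauto, rfl⟩
      · rw [this, card_edgeSimplex hbc]
        exact ⟨by intro z; simp [edgeSimplex, triangleSimplex]; tauto, rfl⟩
  unfold boundaryMatrix
  simp only [key, Pi.add_apply, Pi.single_apply]
  by_cases h1 : ρ = edgeSimplex a b
  · subst h1; simp [n1, n2]
  by_cases h2 : ρ = edgeSimplex a c
  · subst h2; simp [n1.symm, n3]
  simp [h1, h2]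

theorem boundaryMatrix_mulVec_triangle [Fintype V] {a b c : V} (hab : a ≠ b) (hac : a ≠ c) (hbc : b ≠ c) :
    boundaryMatrix V *ᵥ Pi.single (triangleSimplex a b c) 1 =
      Pi.single (edgeSimplex a b) 1 + Pi.single (edgeSimplex a c) 1 +
        Pi.single (edgeSimplex b c) 1 := by
  ext ρ
  rw [Matrix.mulVec_single_one]
  exact boundaryMatrix_triangle_apply hab hac hbc ρ

/-- The cut cochain of a set `S` of vertices: `1` on the edges with exactly one endpoint in `S`, and
`0` on all other simplices. -/
noncomputable def cutCochain (S : V → Prop) (ρ : Simplex V) : ZMod 2 :=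
  open Classical in if ρ.1.card = 2 then ∑ x ∈ ρ.1, if S x then 1 else 0 else 0

theorem cutCochain_edgeSimplex (S : V → Prop) [DecidablePred S] {a b : V} (h : a ≠ b) :
    cutCochain S (edgeSimplex a b) = (if S a then 1 else 0) + if S b then 1 else 0 := by
  rw [cutCochain, if_pos (card_edgeSimplex h)]
  show ∑ x ∈ ({a, b} : Finset V), _ = _
  rw [Finset.sum_pair h]
  congr

variable [Fintype V]

/-- Every boundary crosses a cut an even number of times: the cut cochain is a coboundary. -/
theorem cutCochain_boundary (S : V → Prop) (c : Simplex V → ZMod 2) :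
    cutCochain S ⬝ᵥ (boundaryMatrix V *ᵥ c) = 0 := by
  classical
  rw [Matrix.dotProduct_mulVec]
  suffices h : cutCochain S ᵥ* boundaryMatrix V = 0 by rw [h, zero_dotProduct]
  ext τ
  show cutCochain S ⬝ᵥ (fun ρ => boundaryMatrix V ρ τ) = 0
  by_cases h3 : τ.1.card = 3
  · obtain ⟨a, b, c, hab, hac, hbc, he⟩ := Finset.card_eq_three.1 h3
    obtain rfl : τ = triangleSimplex a b c := Subtype.ext he
    rw [funext (boundaryMatrix_triangle_apply hab hac hbc)]
    simp only [dotProduct_add, dotProduct_single_one, cutCochain_edgeSimplex S hab,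
      cutCochain_edgeSimplex S hac, cutCochain_edgeSimplex S hbc]
    split_ifs <;> decide
  -- The cochain lives on edges, and only triangles have edges in their boundary.
  · refine Finset.sum_eq_zero fun ρ _ => ?_
    by_cases h2 : ρ.1.card = 2
    · have : ¬ (ρ.1 ⊆ τ.1 ∧ τ.1.card = ρ.1.card + 1) := by omega
      have h0 : boundaryMatrix V ρ τ = 0 := if_neg this
      exact mul_eq_zero_of_right _ h0
    · simp [cutCochain, h2]

/-- If the edge `vw` occurs in a boundary and every other edge of that boundary has
equivalent endpoints, then `v` and `w` are equivalent as well. -/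
theorem related_of_boundary_ne_zero {r : V → V → Prop} (hr : Equivalence r)
    {c : Simplex V → ZMod 2} {v w : V} (hvw : v ≠ w)
    (hne : (boundaryMatrix V *ᵥ c) (edgeSimplex v w) ≠ 0)
    (h : ∀ a b, a ≠ b → edgeSimplex a b ≠ edgeSimplex v w →
      (boundaryMatrix V *ᵥ c) (edgeSimplex a b) ≠ 0 → r a b) : r v w := by
  classical
  by_contra hnot
  have hz := cutCochain_boundary (r v) c
  have hs : cutCochain (r v) ⬝ᵥ (boundaryMatrix V *ᵥ c) =
      cutCochain (r v) (edgeSimplex v w) * (boundaryMatrix V *ᵥ c) (edgeSimplex v w) := by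
    refine Finset.sum_eq_single _ (fun ρ _ hρ => ?_) (by simp)
    by_cases h2 : ρ.1.card = 2
    · obtain ⟨a, b, hab, rfl⟩ := exists_edgeSimplex_eq h2
      by_cases h0 : (boundaryMatrix V *ᵥ c) (edgeSimplex a b) = 0
      · rw [h0, mul_zero]
      · have hrab := h a b hab hρ h0
        have hiff : r v a ↔ r v b :=
          ⟨fun h => hr.trans h hrab, fun h => hr.trans h (hr.symm hrab)⟩
        rw [cutCochain_edgeSimplex _ hab]
        simp only [hiff]
        rw [CharTwo.add_self_eq_zero, zero_mul]
    · simp [cutCochain, h2]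
  rw [hz, cutCochain_edgeSimplex _ hvw, if_pos (hr.refl v), if_neg hnot, add_zero, one_mul] at hs
  exact hne hs.symm

end Boundary

/-! ### Edges joined before a given simplex -/

section Reachable

variable {V : Type*} [DecidableEq V]

/-- The edge `{a, b}` comes before `σ` in the filtration order of `d`. -/
def EdgePrecedes (d : V → V → ℝ) (π : SimplexOrder V) (σ : Simplex V) (a b : V) : Prop :=
  filtrationKey d π (edgeSimplex a b) < filtrationKey d π σ

theorem EdgePrecedes.symm {d : V → V → ℝ} {π : SimplexOrder V} {σ : Simplex V} {a b : V}
    (h : EdgePrecedes d π σ a b) : EdgePrecedes d π σ b a := by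
  rwa [EdgePrecedes, edgeSimplex_comm]

theorem equivalence_reachable (d : V → V → ℝ) (π : SimplexOrder V) (σ : Simplex V) :
    Equivalence (Relation.ReflTransGen (EdgePrecedes d π σ)) :=
  haveI : Std.Symm (EdgePrecedes d π σ) := ⟨fun _ _ => EdgePrecedes.symm⟩
  ⟨fun _ => .refl, fun h => Relation.ReflTransGen.stdSymm.symm _ _ h, fun h h' => h.trans h'⟩

/-- If edges preceding `{v, w}` join `v` to `w`, then coning off the path from `v` gives a
chain whose boundary is led by `{v, w}`. -/
theorem exists_isLeading_boundary_of_reachable [Fintype V] {d : V → V → ℝ} {π : SimplexOrder V}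
    {v w : V} (hvw : v ≠ w)
    (h : Relation.ReflTransGen (EdgePrecedes d π (edgeSimplex v w)) v w) :
    ∃ c, IsLeading d π (boundaryMatrix V *ᵥ c) (edgeSimplex v w) := by
  have two : ∀ a b : ZMod 2, a ≠ 0 → b ≠ 0 → a + b = 0 := by decide
  -- Along the path, the boundary of the partial cone is the edge from `v` to the current vertex,
  -- up to edges preceding `{v, w}`.
  have key : ∀ u, Relation.ReflTransGen (EdgePrecedes d π (edgeSimplex v w)) v u → u ≠ v →
      ∃ c : Simplex V → ZMod 2, ∀ ρ,
        (boundaryMatrix V *ᵥ c + Pi.single (edgeSimplex v u) 1 : Simplex V → ZMod 2) ρ ≠ 0 →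
        filtrationKey d π ρ < filtrationKey d π (edgeSimplex v w) := by
    intro u hu
    induction hu with
    | refl => exact fun h => absurd rfl h
    | @tail u u' _ huu' ih =>
      intro hu'
      by_cases huv : u = v
      · subst huv
        refine ⟨0, fun ρ hρ => ?_⟩
        rw [Matrix.mulVec_zero, zero_add, Pi.single_apply] at hρ
        have : ρ = edgeSimplex u u' := by
          by_contra hne
          exact hρ (if_neg hne)
        rw [this]
        exact huu'
      obtain ⟨c, hc⟩ := ih huv
      by_cases hne : u = u'
      · exact hne ▸ ⟨c, hc⟩
      refine ⟨c + Pi.single (triangleSimplex v u u') 1, fun ρ hρ => ?_⟩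
      rw [Matrix.mulVec_add,
        boundaryMatrix_mulVec_triangle (Ne.symm huv) (Ne.symm hu') hne] at hρ
      have hsum : (boundaryMatrix V *ᵥ c + (Pi.single (edgeSimplex v u) 1 +
          Pi.single (edgeSimplex v u') 1 + Pi.single (edgeSimplex u u') 1) +
          Pi.single (edgeSimplex v u') 1 : Simplex V → ZMod 2) ρ =
          (boundaryMatrix V *ᵥ c + Pi.single (edgeSimplex v u) 1 : Simplex V → ZMod 2) ρ +
            (Pi.single (edgeSimplex u u') 1 : Simplex V → ZMod 2) ρ := by
        simp only [Pi.add_apply]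
        linear_combination CharTwo.add_self_eq_zero
          ((Pi.single (edgeSimplex v u') 1 : Simplex V → ZMod 2) ρ)
      rw [hsum] at hρ
      by_cases hρu : ρ = edgeSimplex u u'
      · rw [hρu]
        exact huu'
      · rw [Pi.single_eq_of_ne hρu, add_zero] at hρ
        exact hc ρ hρ
  obtain ⟨c, hc⟩ := key w h hvw.symm
  refine ⟨c, fun h0 => ?_, fun ρ hρ => ?_⟩
  · refine lt_irrefl _ (hc (edgeSimplex v w) ?_)
    rw [Pi.add_apply, h0, Pi.single_eq_same, zero_add]
    exact one_ne_zero
  · by_cases he : ρ = edgeSimplex v w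
    · rw [he]
    · refine (hc ρ ?_).le
      rwa [Pi.add_apply, Pi.single_eq_of_ne he, add_zero]

end Reachable

/-! ### Path-representable distances -/

section Distance

variable {V : Type*} {G : SimpleGraph V} {W : Sym2 V → ℝ} {g : PathChoice G} {d : V → V → ℝ}

theorem walkWeight_pos (hW : ∀ e ∈ G.edgeSet, 0 < W e) {v w : V} (p : G.Walk v w) (h : v ≠ w) :
    0 < walkWeight W p := by
  refine List.sum_pos _ ?_ ?_
  · intro x hx
    obtain ⟨e, he, rfl⟩ := List.mem_map.1 hx
    exact hW e (p.edges_subset_edgeSet he)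
  · cases p with
    | nil => exact absurd rfl h
    | cons => simp

theorem walkWeight_cons {u v w : V} (h : G.Adj u v) (p : G.Walk v w) :
    walkWeight W (SimpleGraph.Walk.cons h p) = W s(u, v) + walkWeight W p := by
  simp [walkWeight]

theorem PathChoice.path_self (g : PathChoice G) (v : V) : g.path v v = .nil := by
  have h := g.isPath v v
  generalize g.path v v = p at h ⊢
  exact (SimpleGraph.Walk.isPath_iff_nil.1 h).eq_nil

theorem PathChoice.IsDistanceAlong.dist_self (hd : g.IsDistanceAlong W d) (v : V) : d v v = 0 := by
  rw [hd.2, g.path_self]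
  simp [walkWeight]

theorem PathChoice.IsDistanceAlong.dist_pos (hd : g.IsDistanceAlong W d)
    (hW : ∀ e ∈ G.edgeSet, 0 < W e) {v w : V} (h : v ≠ w) : 0 < d v w := by
  rw [hd.2]
  exact walkWeight_pos hW _ h

/-- A selected path is a single edge or is split by its second vertex into two shorter selected
paths. -/
theorem adj_or_exists_split (hd : g.IsDistanceAlong W d) {v w : V} (h : v ≠ w) :
    (G.Adj v w ∧ d v w = W s(v, w)) ∨
      ∃ x, x ≠ v ∧ x ≠ w ∧ d v w = d v x + d x w ∧
        (g.path v x).length < (g.path v w).length ∧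
        (g.path x w).length < (g.path v w).length := by
  have hdef := hd.2 v w
  have hcons := fun x y p q r => g.consistent v x y w p q r
  generalize g.path v w = p at hdef hcons ⊢
  cases p with
  | nil => exact absurd rfl h
  | @cons _ x _ hadj q =>
    cases q with
    | nil => exact .inl ⟨hadj, by simpa [walkWeight] using hdef⟩
    | @cons _ y _ hadj' q =>
      have e1 : g.path v x = .cons hadj .nil :=
        hcons v x .nil (.cons hadj .nil) (.cons hadj' q) rfl
      have e2 : g.path x w = .cons hadj' q :=
        hcons x w (.cons hadj .nil) (.cons hadj' q) .nil (by simp)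
      refine .inr ⟨x, hadj.ne', ?_, ?_, ?_, ?_⟩
      · rintro rfl
        rw [g.path_self] at e2
        simpa using congrArg SimpleGraph.Walk.length e2
      · rw [hdef, hd.2, hd.2, e1, e2, walkWeight_cons, walkWeight_cons (W := W) hadj .nil]
        simp [walkWeight]
      · rw [e1]; simp
      · rw [e2]; simp

variable [DecidableEq V]

theorem ripsValue_edgeSimplex (hW : ∀ e ∈ G.edgeSet, 0 < W e) (hd : g.IsDistanceAlong W d)
    {a b : V} (h : a ≠ b) : ripsValue d (edgeSimplex a b) = d a b := by
  have hpos := (hd.dist_pos hW h).le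
  refine le_antisymm (Finset.sup'_le _ _ ?_)
    (Finset.le_sup' (f := fun x : V × V => d x.1 x.2) (b := (a, b)) (by simp [edgeSimplex]))
  rintro ⟨x, y⟩ hxy
  simp only [edgeSimplex, Finset.mem_product, Finset.mem_insert, Finset.mem_singleton] at hxy
  rcases hxy with ⟨rfl | rfl, rfl | rfl⟩
  · rwa [hd.dist_self]
  · exact le_rfl
  · exact (hd.1 _ _).le
  · rwa [hd.dist_self]

/-- Only edges of `G` that are themselves selected give bars of positive length: another pair
`{v, w}` is the strictly longest edge of a triangle `{v, x, w}` of the same filtration value. -/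
theorem adj_of_isLow_of_lt [Fintype V] (hW : ∀ e ∈ G.edgeSet, 0 < W e)
    (hd : g.IsDistanceAlong W d) {π : SimplexOrder V} (A : Reduction d π) {v w : V} (h : v ≠ w)
    {τ : Simplex V} (hlow : IsLow d π A.R (edgeSimplex v w) τ)
    (hlt : ripsValue d (edgeSimplex v w) < ripsValue d τ) :
    G.Adj v w ∧ d v w = W s(v, w) := by
  rcases adj_or_exists_split hd h with h' | ⟨x, hxv, hxw, hsum, -, -⟩
  · exact h'
  exfalso
  have p1 := hd.dist_pos hW hxv.symm
  have p2 := hd.dist_pos hW hxw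
  have hlead : IsLeading d π
      (boundaryMatrix V *ᵥ Pi.single (triangleSimplex v x w) 1) (edgeSimplex v w) := by
    rw [boundaryMatrix_mulVec_triangle hxv.symm h hxw]
    constructor
    · rw [Pi.add_apply, Pi.add_apply, Pi.single_eq_same, Pi.single_eq_of_ne, Pi.single_eq_of_ne,
        zero_add, add_zero]
      · exact one_ne_zero
      · rw [edgeSimplex_comm v w, edgeSimplex_comm x w]
        exact edgeSimplex_ne_of_ne h hxv.symm
      · exact edgeSimplex_ne_of_ne h.symm hxw.symm
    · intro ρ hρ
      by_cases h1 : ρ = edgeSimplex v x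
      · subst h1
        refine filtrationKey_le_iff.2 (.inl ?_)
        rw [ripsValue_edgeSimplex hW hd hxv.symm, ripsValue_edgeSimplex hW hd h]
        linarith
      by_cases h2 : ρ = edgeSimplex x w
      · subst h2
        refine filtrationKey_le_iff.2 (.inl ?_)
        rw [ripsValue_edgeSimplex hW hd hxw, ripsValue_edgeSimplex hW hd h]
        linarith
      by_cases h3 : ρ = edgeSimplex v w
      · rw [h3]
      · simp [h1, h2, h3] at hρ
  obtain ⟨τ', hlow', ρ, hρ, hle⟩ := A.exists_isLow hlead
  obtain rfl := A.reduced _ _ _ hlow hlow'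
  have hρ' : ρ = triangleSimplex v x w := by
    by_contra hne
    exact hρ (Pi.single_eq_of_ne hne _)
  subst hρ'
  refine absurd (hlt.trans_le hle) (not_lt.2 (Finset.sup'_le _ _ ?_))
  rw [ripsValue_edgeSimplex hW hd h]
  rintro ⟨a, b⟩ hab
  simp only [triangleSimplex, Finset.mem_product, Finset.mem_insert, Finset.mem_singleton] at hab
  have s1 := hd.1 x v
  have s2 := hd.1 w x
  have s3 := hd.1 w v
  have z := hd.dist_self
  rcases hab with ⟨rfl | rfl | rfl, rfl | rfl | rfl⟩ <;> simp only [z] <;> linarith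

end Distance

/-! ### Comparison of two distances -/

section Comparison

variable {V : Type*} {G : SimpleGraph V} {W : Sym2 V → ℝ} {g₁ g₂ : PathChoice G}
  {d₁ d₂ : V → V → ℝ}

theorem dist_eq_of_adj (hg₁ : g₁.CostDominated W) (hd₁ : g₁.IsDistanceAlong W d₁)
    (hle : ∀ v w : V, d₂ v w ≤ d₁ v w) {v w : V} (hadj : G.Adj v w) (hW₂ : d₂ v w = W s(v, w)) :
    d₁ v w = d₂ v w :=
  le_antisymm (by rw [hd₁.2, hW₂]; exact hg₁ v w hadj) (hle v w)

variable [DecidableEq V]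

/-- If `σ` has the same value for both distances, then the endpoints of an edge that precedes `σ`
for `d₂` are joined by edges that precede `σ` for `d₁`. -/
theorem precedes_reachable (hW : ∀ e ∈ G.edgeSet, 0 < W e) (hg₁ : g₁.CostDominated W)
    (hd₁ : g₁.IsDistanceAlong W d₁) (hd₂ : g₂.IsDistanceAlong W d₂)
    (hle : ∀ v w : V, d₂ v w ≤ d₁ v w) {π : SimplexOrder V} {σ : Simplex V}
    (hσ : ripsValue d₁ σ = ripsValue d₂ σ) (n : ℕ) :
    ∀ a b : V, (g₂.path a b).length = n → EdgePrecedes d₂ π σ a b →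
      Relation.ReflTransGen (EdgePrecedes d₁ π σ) a b := by
  induction n using Nat.strong_induction_on with
  | _ n ih =>
    intro a b hn hab
    by_cases hne : a = b
    · exact hne ▸ .refl
    rcases adj_or_exists_split hd₂ hne with ⟨hadj, hWab⟩ | ⟨x, hxa, hxb, hsum, hl1, hl2⟩
    · refine .single ?_
      have hr : ripsValue d₁ (edgeSimplex a b) = ripsValue d₂ (edgeSimplex a b) := by
        rw [ripsValue_edgeSimplex hW hd₁ hne, ripsValue_edgeSimplex hW hd₂ hne]
        exact dist_eq_of_adj hg₁ hd₁ hle hadj hWab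
      unfold EdgePrecedes filtrationKey at hab ⊢
      rwa [hr, hσ]
    · have p1 := hd₂.dist_pos hW hxa.symm
      have p2 := hd₂.dist_pos hW hxb
      have hv := ripsValue_le_of_filtrationKey_le hab.le
      rw [ripsValue_edgeSimplex hW hd₂ hne] at hv
      refine (ih _ (hn ▸ hl1) a x rfl ?_).trans (ih _ (hn ▸ hl2) x b rfl ?_) <;>
        refine filtrationKey_lt_iff.2 (.inl ?_)
      · rw [ripsValue_edgeSimplex hW hd₂ hxa.symm]
        linarith
      · rw [ripsValue_edgeSimplex hW hd₂ hxb]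
        linarith

variable [Fintype V]

/-- The birth edge of a bar of `d₂` has the same value for `d₁`, and it is the birth edge of a bar
of `d₁` that dies no earlier. -/
theorem exists_bar_of_bar (hW : ∀ e ∈ G.edgeSet, 0 < W e) (hg₁ : g₁.CostDominated W)
    (hd₁ : g₁.IsDistanceAlong W d₁) (hd₂ : g₂.IsDistanceAlong W d₂)
    (hle : ∀ v w : V, d₂ v w ≤ d₁ v w) {π : SimplexOrder V} (A₁ : Reduction d₁ π)
    (A₂ : Reduction d₂ π) {σ τ : Simplex V} (hbar : (σ, τ) ∈ A₂.barcodeOne) :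
    ∃ τ', (σ, τ') ∈ A₁.barcodeOne ∧ ripsValue d₁ σ = ripsValue d₂ σ ∧
      ripsValue d₂ τ ≤ ripsValue d₁ τ' := by
  obtain ⟨hcard, hlow, hlt⟩ := hbar
  dsimp only at hcard hlow hlt
  obtain ⟨v, w, hvw, rfl⟩ := exists_edgeSimplex_eq hcard
  obtain ⟨hadj, hWvw⟩ := adj_of_isLow_of_lt hW hd₂ A₂ hvw hlow hlt
  have hσ : ripsValue d₁ (edgeSimplex v w) = ripsValue d₂ (edgeSimplex v w) := by
    rw [ripsValue_edgeSimplex hW hd₁ hvw, ripsValue_edgeSimplex hW hd₂ hvw]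
    exact dist_eq_of_adj hg₁ hd₁ hle hadj hWvw
  have hlead₂ := A₂.isLeading_of_isLow hlow
  have hreach : Relation.ReflTransGen (EdgePrecedes d₁ π (edgeSimplex v w)) v w :=
    related_of_boundary_ne_zero (equivalence_reachable d₁ π _) hvw hlead₂.1
      fun a b _ hne h0 => precedes_reachable hW hg₁ hd₁ hd₂ hle hσ _ a b rfl
        (lt_of_le_of_ne (hlead₂.2 _ h0) fun he => hne (filtrationKey_injective d₂ π he))
  obtain ⟨c, hc⟩ := exists_isLeading_boundary_of_reachable hvw hreach
  obtain ⟨τ', hlow', -⟩ := A₁.exists_isLow hc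
  have hlead₁ := A₁.isLeading_of_isLow hlow'
  -- The chain realizing the pair `(σ, τ')` for `d₁` also has a boundary led by `σ` for `d₂`.
  have hlead : IsLeading d₂ π (boundaryMatrix V *ᵥ fun ρ => A₁.U ρ τ') (edgeSimplex v w) := by
    refine ⟨hlead₁.1, fun ρ hρ => ?_⟩
    have hm := ripsValue_mono hle ρ
    rw [filtrationKey_le_iff, ← hσ]
    rcases filtrationKey_le_iff.1 (hlead₁.2 ρ hρ) with h | ⟨h, hr⟩
    · exact .inl (hm.trans_lt h)
    · rcases (hm.trans h.le).lt_or_eq with h' | h'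
      exacts [.inl h', .inr ⟨h', hr⟩]
  obtain ⟨τ'', hlow'', ρ, hρ, hτρ⟩ := A₂.exists_isLow hlead
  obtain rfl := A₂.reduced _ _ _ hlow hlow''
  have hdeath : ripsValue d₂ τ ≤ ripsValue d₁ τ' :=
    hτρ.trans ((ripsValue_mono hle ρ).trans
      (ripsValue_le_of_filtrationKey_le (A₁.upper ρ τ' hρ)))
  exact ⟨τ', ⟨hcard, hlow', by dsimp only; rw [hσ]; exact hlt.trans_le hdeath⟩, hσ, hdeath⟩

end Comparison

theorem mainTheorem1 {V : Type*} [Fintype V] [DecidableEq V] (G : SimpleGraph V)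
    (hG : G.Connected) (W : Sym2 V → ℝ) (hW : ∀ e ∈ G.edgeSet, 0 < W e)
    (g₁ g₂ : PathChoice G) (hg₁ : g₁.CostDominated W) (hg₂ : g₂.CostDominated W)
    (d₁ d₂ : V → V → ℝ) (hd₁ : g₁.IsDistanceAlong W d₁) (hd₂ : g₂.IsDistanceAlong W d₂)
    (hle : ∀ v w : V, d₂ v w ≤ d₁ v w) :
    ∃ π : SimplexOrder V, ∀ (A₁ : Reduction d₁ π) (A₂ : Reduction d₂ π),
      ∃ φ : A₂.barcodeOne → A₁.barcodeOne, Function.Injective φ ∧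
        ∀ x : A₂.barcodeOne,
          Reduction.birthEdge (φ x) = Reduction.birthEdge x ∧
          Reduction.birth (φ x) = Reduction.birth x ∧
          Reduction.death x ≤ Reduction.death (φ x) := by
  obtain ⟨π⟩ := nonempty_simplexOrder (V := V)
  refine ⟨π, fun A₁ A₂ => ?_⟩
  choose τ hbar hbirth hdeath using fun x : A₂.barcodeOne =>
    exists_bar_of_bar hW hg₁ hd₁ hd₂ hle A₁ A₂ x.2
  refine ⟨fun x => ⟨(x.1.1, τ x), hbar x⟩, fun x y hxy => ?_, fun x =>
    ⟨rfl, hbirth x, hdeath x⟩⟩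
  have h1 : x.1.1 = y.1.1 := congrArg (fun z => z.1.1) hxy
  have h2 : x.1.2 = y.1.2 := A₂.reduced _ _ _ x.2.2.1 (h1 ▸ y.2.2.1)
  exact Subtype.ext (Prod.ext h1 h2)
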